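/- Let $X$ be a finite set and let $r\colon X\times X\to X\times X$, $r(x,y)=(\sigma_x(y),\tau_y(x))$, be a bijection satisfying the Yang--Baxter equation $r_1r_2r_1=r_2r_1r_2$ on $X^3$, where $r_1=r\times\mathrm{Id}_X$ and $r_2=\mathrm{Id}_X\times r$, and such that all maps $\sigma_x,\tau_x\colon X\to X$ are bijective. We use the following notation. - $G=G_{(X,r)}=\langle X \mid xy=\sigma_x(y)\tau_y(x),\ x,y\in X\rangle$ is the structure group, and $\iota\colon X\to G$ is the natural map. The group $G$ acts on $X$ on the right by $x\leftharpoonup y=\tau_y(x)$ and on the left by $y\rightharpoonup x=\sigma_y(x)$ ($x,y\in X$). - $x\lhd y=\tau_y\,\sigma_{\tau_x^{-1}(y)}(x)$ is the operation of the structure rack $(X,\lhd)$, $\rho_y\colon x\mapsto x\lhd y$ are its right translations, and $K_r$ is the number of orbits of $X$ with respect to the maps $\rho_y$, $y\in X$. - $G'=\langle X\mid xy=(y\lhd x)\,x,\ x,y\in X\rangle$. The group $G$ acts on $G'$ on the right by group automorphisms, $(h,g)\mapsto h^g$, extending its right action $\leftharpoonup$ on the generators. $J\colon G\to G'$ is the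 unique map with $J(gh)=J(g)^hJ(h)$ for all $g,h\in G$ and $J(x)=x$ for all $x\in X$; it is bijective. - For $y\in X$ and $d\in\mathbb{N}$, the $T$-twisted power is $y^{[d]}=J^{-1}(y^d)\in G$. The degree $d_y$ is the least positive integer $d$ such that (i) $d$ is even if $\rho_y=\mathrm{Id}_X$, (ii) $\rho_y^d=\mathrm{Id}_X$, and (iii) $x\leftharpoonup y^{[d]}=x=y^{[d]}\rightharpoonup x$ for all $x\in X$. Such a $d$ always exists. Let $Z_{(X,r)}$ be the subgroup of $G_{(X,r)}$ generated by the elements $x^{[d_x]}$, $x\in X$. Then: 1. $Z_{(X,r)}$ is a normal subgroup of $G_{(X,r)}$. 2. $Z_{(X,r)}$ is free abelian of rank $K_r$. 3. The quotient $\overline{G}_{(X,r)}=G_{(X,r)}/Z_{(X,r)}$ is finite. 4. The map $\iota\colon X\to G_{(X,r)}$ is injective if and only if its composition with the quotient map $G_{(X,r)}\to\overline{G}_{(X,r)}$ is injective. -/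

import Mathlib

universe u

namespace YBE

/-- `r × Id` acting on triples. -/
def r₁ {X : Type u} (r : X × X → X × X) : X × X × X → X × X × X :=
  fun p => ((r (p.1, p.2.1)).1, (r (p.1, p.2.1)).2, p.2.2)

/-- `Id × r` acting on triples. -/
def r₂ {X : Type u} (r : X × X → X × X) : X × X × X → X × X × X :=
  fun p => (p.1, r p.2)

/-- An invertible non-degenerate set-theoretic solution of the Yang–Baxter equation on `X`;
here `r (x, y) = (σ_x y, τ_y x)`. -/
structure Solution (X : Type u) where
  r : X × X → X × X
  bijective : Function.Bijective r
  sigma_bijective : ∀ x, Function.Bijective fun y => (r (x, y)).1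
  tau_bijective : ∀ y, Function.Bijective fun x => (r (x, y)).2
  yangBaxter : r₁ r ∘ r₂ r ∘ r₁ r = r₂ r ∘ r₁ r ∘ r₂ r

/-- The group `⟨X | x y = a b whenever r (x, y) = (a, b)⟩`. -/
abbrev StructureGroup {X : Type u} (r : X × X → X × X) : Type u :=
  PresentedGroup {w : FreeGroup X | ∃ x y : X,
    w = FreeGroup.of x * FreeGroup.of y *
      (FreeGroup.of (r (x, y)).1 * FreeGroup.of (r (x, y)).2)⁻¹}

namespace StructureGroup

variable {X : Type u} {r : X × X → X × X}

/-- The natural map from `X` to the structure group. -/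
def ι (r : X × X → X × X) (x : X) : StructureGroup r := PresentedGroup.of x

theorem ι_rel (x y : X) : ι r x * ι r y = ι r (r (x, y)).1 * ι r (r (x, y)).2 := by
  have h := PresentedGroup.one_of_mem
    (rels := {w : FreeGroup X | ∃ x y : X, w = FreeGroup.of x * FreeGroup.of y *
      (FreeGroup.of (r (x, y)).1 * FreeGroup.of (r (x, y)).2)⁻¹}) ⟨x, y, rfl⟩
  rw [map_mul, map_inv, mul_inv_eq_one, map_mul, map_mul] at h
  exact h

/-- The universal property of the structure group. -/
def lift {H : Type*} [Group H] (f : X → H)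
    (hf : ∀ x y, f x * f y = f (r (x, y)).1 * f (r (x, y)).2) : StructureGroup r →* H :=
  PresentedGroup.toGroup (f := f) (by
    rintro w ⟨x, y, rfl⟩
    simp only [map_mul, map_inv, FreeGroup.lift_apply_of]
    rw [mul_inv_eq_one]
    exact hf x y)

@[simp] theorem lift_ι {H : Type*} [Group H] (f : X → H)
    (hf : ∀ x y, f x * f y = f (r (x, y)).1 * f (r (x, y)).2) (x : X) :
    lift f hf (ι r x) = f x :=
  PresentedGroup.toGroup.of _

theorem hom_ext {H : Type*} [Group H] {f g : StructureGroup r →* H}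
    (h : ∀ x, f (ι r x) = g (ι r x)) : f = g :=
  PresentedGroup.ext h

theorem induction_left {P : StructureGroup r → Prop} (one : P 1)
    (mul : ∀ x g, P g → P (ι r x * g)) (inv_mul : ∀ x g, P g → P ((ι r x)⁻¹ * g))
    (g : StructureGroup r) : P g := by
  have hg : g ∈ Subgroup.closure (Set.range (ι r)) := by
    have := PresentedGroup.closure_range_of
      {w : FreeGroup X | ∃ x y : X, w = FreeGroup.of x * FreeGroup.of y *
        (FreeGroup.of (r (x, y)).1 * FreeGroup.of (r (x, y)).2)⁻¹}
    exact this ▸ Subgroup.mem_top g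
  induction hg using Subgroup.closure_induction_left with
  | one => exact one
  | mul_left x hx y _ ih => obtain ⟨x, rfl⟩ := hx; exact mul x y ih
  | inv_mul_cancel x hx y _ ih => obtain ⟨x, rfl⟩ := hx; exact inv_mul x y ih

end StructureGroup

namespace Solution

open StructureGroup MulOpposite

variable {X : Type u} (S : Solution X)

/-- `σ_x`. -/
noncomputable def σ (x : X) : Equiv.Perm X := Equiv.ofBijective _ (S.sigma_bijective x)

/-- `τ_y`. -/
noncomputable def τ (y : X) : Equiv.Perm X := Equiv.ofBijective _ (S.tau_bijective y)

theorem r_apply (x y : X) : S.r (x, y) = (S.σ x y, S.τ y x) := rfl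

theorem ybe_components (x y z : X) :
    S.σ (S.σ x y) (S.σ (S.τ y x) z) = S.σ x (S.σ y z) ∧
    S.τ (S.σ (S.τ y x) z) (S.σ x y) = S.σ (S.τ (S.σ y z) x) (S.τ z y) ∧
    S.τ z (S.τ y x) = S.τ (S.τ z y) (S.τ (S.σ y z) x) := by
  have h := congrFun S.yangBaxter (x, y, z)
  simp only [Function.comp, r₁, r₂, r_apply, Prod.mk.injEq] at h
  exact h

/-- The structure group `G_{(X,r)}`. -/
abbrev G : Type u := StructureGroup S.r

/-- The operation `x ◁ y = τ_y (σ_{τ_x⁻¹ y} x)` of the structure rack. -/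
noncomputable def rop (x y : X) : X := S.τ y (S.σ ((S.τ x).symm y) x)

/-- The structure group `G'` of the structure rack, that is, the structure group of the map
`(x, y) ↦ (y ◁ x, x)`. -/
abbrev G' : Type u := StructureGroup fun p : X × X => (S.rop p.2 p.1, p.1)

/-- The natural map from `X` to `G_{(X,r)}`. -/
def ιG : X → S.G := ι S.r

/-- The natural map from `X` to `G'`. -/
noncomputable def ιG' : X → S.G' := ι _

theorem op_τ (a x : X) : S.rop x (S.τ x a) = S.τ (S.τ x a) (S.σ a x) := by
  simp [rop]

theorem τ_op (z x y : X) : S.τ z (S.rop x y) = S.rop (S.τ z x) (S.τ z y) := by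
  obtain ⟨a, rfl⟩ := (S.τ x).surjective y
  have h := S.ybe_components a x z
  have h' := S.ybe_components (S.σ a x) (S.τ x a) z
  rw [op_τ, h.2.2, op_τ, ← h.2.1, h'.2.2, h.2.2]

theorem ιG_rel (x y : X) : S.ιG x * S.ιG y = S.ιG (S.σ x y) * S.ιG (S.τ y x) := ι_rel x y

theorem ιG'_rel (x y : X) : S.ιG' x * S.ιG' y = S.ιG' (S.rop y x) * S.ιG' x := ι_rel x y

/-- The left action of `G_{(X,r)}` on `X` extending `x ⇀ y = σ_x y`. -/
noncomputable def leftAct : S.G →* Equiv.Perm X :=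
  lift S.σ fun x y => Equiv.ext fun z => ((S.ybe_components x y z).1).symm

/-- The right action of `G_{(X,r)}` on `X` extending `x ↼ y = τ_y x`. -/
noncomputable def rightAct : S.G →* (Equiv.Perm X)ᵐᵒᵖ :=
  lift (fun x => MulOpposite.op (S.τ x)) fun y z => unop_injective <|
    Equiv.ext fun x => (S.ybe_components x y z).2.2

/-- `x ↼ g`. -/
noncomputable def ract (x : X) (g : S.G) : X := (S.rightAct g).unop x

@[simp] theorem ract_one (x : X) : S.ract x 1 = x := by simp [ract]

theorem ract_mul (x : X) (g h : S.G) : S.ract x (g * h) = S.ract (S.ract x g) h := by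
  simp [ract]

@[simp] theorem ract_ι (x y : X) : S.ract x (S.ιG y) = S.τ y x := by
  simp [ract, ιG, rightAct]

@[simp] theorem ract_ι_inv (x y : X) : S.ract x (S.ιG y)⁻¹ = (S.τ y).symm x := by
  simp [ract, ιG, rightAct]

/-- The automorphisms of the structure rack. -/
def rackAut : Subgroup (Equiv.Perm X) where
  carrier := {e | ∀ x y, e (S.rop x y) = S.rop (e x) (e y)}
  one_mem' := fun _ _ => rfl
  mul_mem' := fun {a b} ha hb x y => by
    simp only [Set.mem_ofPred_eq] at ha hb
    simp [ha, hb]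
  inv_mem' := fun {a} ha x y => by
    simp only [Set.mem_ofPred_eq] at ha
    apply a.injective
    rw [ha]
    simp

theorem rightAct_mem (g : S.G) : (S.rightAct g).unop ∈ S.rackAut := by
  have hτ : ∀ x, (S.rightAct (ι S.r x)).unop ∈ S.rackAut := fun x => by
    rw [rightAct, lift_ι]
    exact S.τ_op x
  induction g using induction_left with
  | one => simp [S.rackAut.one_mem]
  | mul x g hg => rw [map_mul, unop_mul]; exact S.rackAut.mul_mem hg (hτ x)
  | inv_mul x g hg =>
    rw [map_mul, unop_mul, map_inv, unop_inv]
    exact S.rackAut.mul_mem hg (S.rackAut.inv_mem (hτ x))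

theorem ract_op (x y : X) (g : S.G) : S.ract (S.rop x y) g = S.rop (S.ract x g) (S.ract y g) :=
  S.rightAct_mem g x y

/-- The endomorphism of `G'` induced by an automorphism of the structure rack. -/
noncomputable def rackMap (e : S.rackAut) : S.G' →* S.G' :=
  lift (fun x => S.ιG' (e.1 x)) fun x y => by
    have h := e.2 y x
    simp only [h]
    exact S.ιG'_rel _ _

@[simp] theorem rackMap_ι (e : S.rackAut) (x : X) : S.rackMap e (S.ιG' x) = S.ιG' (e.1 x) :=
  lift_ι _ _ x

/-- The action of the automorphism group of the structure rack on `G'`. -/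
noncomputable def rackAutHom : S.rackAut →* MulAut S.G' where
  toFun e :=
    MonoidHom.toMulEquiv (S.rackMap e) (S.rackMap e⁻¹)
      (hom_ext fun x => by
        change S.rackMap e⁻¹ (S.rackMap e (S.ιG' x)) = S.ιG' x
        simp)
      (hom_ext fun x => by
        change S.rackMap e (S.rackMap e⁻¹ (S.ιG' x)) = S.ιG' x
        simp)
  map_one' := by
    apply MulEquiv.toMonoidHom_injective
    refine hom_ext fun x => ?_
    change S.rackMap 1 (S.ιG' x) = S.ιG' x
    simp
  map_mul' e f := by
    apply MulEquiv.toMonoidHom_injective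
    refine hom_ext fun x => ?_
    change S.rackMap (e * f) (S.ιG' x) = S.rackMap e (S.rackMap f (S.ιG' x))
    simp

/-- The right action of `G_{(X,r)}` on `G'` by group automorphisms: `h ◂ g`. -/
noncomputable def gact (h : S.G') (g : S.G) : S.G' :=
  S.rackAutHom ⟨(S.rightAct g).unop, S.rightAct_mem g⟩ h

@[simp] theorem gact_ι (x : X) (g : S.G) : S.gact (S.ιG' x) g = S.ιG' (S.ract x g) :=
  S.rackMap_ι _ x

@[simp] theorem gact_one_right (h : S.G') : S.gact h 1 = h := by
  have : (⟨(S.rightAct 1).unop, S.rightAct_mem 1⟩ : S.rackAut) = 1 := by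
    ext1; simp
  unfold gact
  rw [this, map_one, MulAut.one_apply]

theorem gact_mul_right (h : S.G') (a b : S.G) : S.gact h (a * b) = S.gact (S.gact h a) b := by
  have : (⟨(S.rightAct (a * b)).unop, S.rightAct_mem (a * b)⟩ : S.rackAut) =
      ⟨(S.rightAct b).unop, S.rightAct_mem b⟩ * ⟨(S.rightAct a).unop, S.rightAct_mem a⟩ := by
    ext1; simp
  unfold gact
  rw [this, map_mul, MulAut.mul_apply]

@[simp] theorem gact_one_left (g : S.G) : S.gact 1 g = 1 := map_one _

theorem gact_mul_left (h k : S.G') (g : S.G) : S.gact (h * k) g = S.gact h g * S.gact k g :=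
  map_mul _ _ _

/-- The permutation `h ↦ (h ◂ x) x` of `G'`. -/
noncomputable def affinePerm (x : X) : Equiv.Perm S.G' where
  toFun h := S.gact h (S.ιG x) * S.ιG' x
  invFun h := S.gact (h * (S.ιG' x)⁻¹) (S.ιG x)⁻¹
  left_inv h := by simp [← gact_mul_right]
  right_inv h := by simp [← gact_mul_right]

/-- The right action of `G_{(X,r)}` on the set `G'` in which `x` acts as `h ↦ (h ◂ x) x`. -/
noncomputable def affineAct : S.G →* (Equiv.Perm S.G')ᵐᵒᵖ :=
  lift (fun x => MulOpposite.op (S.affinePerm x)) fun x y => unop_injective <| Equiv.ext fun h => by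
    change S.gact (S.gact h (S.ιG x) * S.ιG' x) (S.ιG y) * S.ιG' y =
      S.gact (S.gact h (S.ιG (S.σ x y)) * S.ιG' (S.σ x y)) (S.ιG (S.τ y x)) * S.ιG' (S.τ y x)
    rw [gact_mul_left, gact_mul_left, ← gact_mul_right, ← gact_mul_right, ιG_rel, mul_assoc,
      mul_assoc, gact_ι, gact_ι, ract_ι, ract_ι, ιG'_rel, op_τ]

/-- The guitar map `J : G_{(X,r)} → G'`; it is the unique group 1-cocycle with `J x = x` on `X`,
and it is bijective, see the lemmas below. -/
noncomputable def J (g : S.G) : S.G' := (S.affineAct g).unop 1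

theorem affineAct_apply (g : S.G) (h : S.G') : (S.affineAct g).unop h = S.gact h g * S.J g := by
  induction g using induction_left generalizing h with
  | one => simp [J]
  | mul x g hg =>
    have e : ∀ k, (S.affineAct (ι S.r x)).unop k = S.gact k (S.ιG x) * S.ιG' x := fun k => by
      rw [affineAct, lift_ι]; rfl
    simp only [J, map_mul, unop_mul, Equiv.Perm.mul_apply]
    rw [hg, hg, e, e, gact_one_left, one_mul, gact_mul_left, ← gact_mul_right, mul_assoc]
    rfl
  | inv_mul x g hg =>
    have e : ∀ k, (S.affineAct (ι S.r x)⁻¹).unop k =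
        S.gact (k * (S.ιG' x)⁻¹) (S.ιG x)⁻¹ := fun k => by
      rw [map_inv, affineAct, lift_ι]; rfl
    simp only [J, map_mul, unop_mul, Equiv.Perm.mul_apply]
    rw [hg, hg, e, e, one_mul, ← gact_mul_right, ← gact_mul_right, gact_mul_left, mul_assoc]
    rfl

@[simp] theorem J_ι (x : X) : S.J (S.ιG x) = S.ιG' x := by
  rw [J, affineAct, ιG, lift_ι]
  change S.gact 1 (S.ιG x) * S.ιG' x = _
  simp

@[simp] theorem J_one : S.J 1 = 1 := by simp [J]

/-- `J` is a group 1-cocycle. -/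
theorem J_mul (g h : S.G) : S.J (g * h) = S.gact (S.J g) h * S.J h := by
  rw [← affineAct_apply, J, map_mul, unop_mul, Equiv.Perm.mul_apply]
  rfl

/-- A group 1-cocycle is determined by its values on the generators. -/
theorem J_unique (φ : S.G → S.G') (hι : ∀ x, φ (S.ιG x) = S.ιG' x)
    (hmul : ∀ g h, φ (g * h) = S.gact (φ g) h * φ h) : φ = S.J := by
  have h1 : φ 1 = 1 := by
    have := hmul 1 1
    simpa using this
  funext g
  induction g using induction_left with
  | one => rw [h1, J_one]
  | mul x g hg =>
    change φ (S.ιG x * g) = S.J (S.ιG x * g)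
    rw [hmul, J_mul, hι, J_ι, hg]
  | inv_mul x g hg =>
    change φ ((S.ιG x)⁻¹ * g) = S.J ((S.ιG x)⁻¹ * g)
    have a := hmul (S.ιG x) ((S.ιG x)⁻¹ * g)
    have b := S.J_mul (S.ιG x) ((S.ιG x)⁻¹ * g)
    rw [mul_inv_cancel_left, hι] at a
    rw [mul_inv_cancel_left, J_ι] at b
    exact mul_left_cancel (a.symm.trans (hg.trans b))

theorem T_bijective : Function.Bijective fun y : X => (S.τ y).symm y := by
  have key : ∀ x y, S.τ y x = y → S.τ ((S.σ x).symm x) x = y := by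
    intro x y hxy
    obtain ⟨⟨a, w⟩, haw⟩ := S.bijective.2 (x, y)
    set q := (S.σ y).symm y with hq
    have hyq : S.σ y q = y := by simp [hq]
    have h := congrFun S.yangBaxter (a, w, q)
    simp only [Function.comp, r₁, r₂, haw] at h
    have e1 : S.r (y, q) = (y, S.τ q y) := by rw [r_apply, hyq]
    have e2 : S.r (x, y) = (S.σ x y, y) := by rw [r_apply, hxy]
    simp only [e1, e2, Prod.mk.injEq] at h
    obtain ⟨h1, h2⟩ := h
    have h3 := S.bijective.1 (e1.trans h2)
    rw [Prod.mk.injEq] at h3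
    have h4 : S.r (x, y) = S.r (a, (S.r (w, q)).1) := by
      rw [e2]
      exact Prod.ext h1 h3.1
    have h5 := S.bijective.1 h4
    have hxa : x = a := congrArg Prod.fst h5
    subst hxa
    rw [r_apply, Prod.mk.injEq] at haw
    have hw : w = (S.σ x).symm x := by
      rw [Equiv.eq_symm_apply]; exact haw.1
    rw [← hw]
    exact haw.2
  constructor
  · intro y y' h
    have h : (S.τ y).symm y = (S.τ y').symm y' := h
    have a := key ((S.τ y).symm y) y (by simp)
    have b := key ((S.τ y').symm y') y' (by simp)
    rw [← a, h, b]
  · intro x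
    refine ⟨S.τ ((S.σ x).symm x) x, ?_⟩
    change (S.τ _).symm _ = x
    rw [Equiv.symm_apply_eq]
    have h : ∀ z, S.τ ((S.σ x).symm x) (S.τ x z) =
        S.τ (S.τ ((S.σ x).symm x) x) (S.τ x z) := fun z => by
      have := (S.ybe_components z x ((S.σ x).symm x)).2.2
      simpa using this
    have := h ((S.τ x).symm x)
    simpa using this

/-- The permutation `T : y ↦ τ_y⁻¹ y` of `X`. -/
noncomputable def T : Equiv.Perm X := Equiv.ofBijective _ S.T_bijective

theorem τ_T (y : X) : S.τ y (S.T y) = y := by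
  change S.τ y ((S.τ y).symm y) = y
  simp

theorem ract_T (y : X) : S.ract (S.T y) (S.ιG y) = y := by rw [ract_ι, τ_T]

theorem J_surjective : Function.Surjective S.J := by
  intro h
  induction h using induction_left with
  | one => exact ⟨1, S.J_one⟩
  | mul x h ih =>
    obtain ⟨g, rfl⟩ := ih
    refine ⟨S.ιG (S.ract x g⁻¹) * g, ?_⟩
    rw [J_mul, J_ι, gact_ι, ← ract_mul, inv_mul_cancel, ract_one]
    rfl
  | inv_mul x h ih =>
    obtain ⟨g, rfl⟩ := ih
    refine ⟨(S.ιG (S.T.symm (S.ract x g⁻¹)))⁻¹ * g, ?_⟩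
    set a := S.T.symm (S.ract x g⁻¹) with ha
    have hx : S.ract (S.T a) g = x := by
      rw [ha, Equiv.apply_symm_apply, ← ract_mul, inv_mul_cancel, ract_one]
    have e := S.J_mul (S.ιG a) ((S.ιG a)⁻¹ * g)
    rw [mul_inv_cancel_left, J_ι, gact_ι, ract_mul, ract_ι_inv] at e
    change S.J g = S.ιG' (S.ract (S.T a) g) * _ at e
    rw [hx] at e
    rw [e]
    exact (inv_mul_cancel_left _ _).symm

/-- The permutation `g ↦ (x ↼ g⁻¹) g` of `G_{(X,r)}`, which `J` turns into left multiplication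
by `x`. -/
noncomputable def leftPerm (x : X) : Equiv.Perm S.G where
  toFun g := S.ιG (S.ract x g⁻¹) * g
  invFun g := (S.ιG (S.T.symm (S.ract x g⁻¹)))⁻¹ * g
  left_inv g := by
    have h : S.T.symm (S.ract x (S.ιG (S.ract x g⁻¹) * g)⁻¹) = S.ract x g⁻¹ := by
      rw [Equiv.symm_apply_eq, mul_inv_rev, ract_mul, ract_ι_inv]
      rfl
    simp only [h, inv_mul_cancel_left]
  right_inv g := by
    have h : S.ract x ((S.ιG (S.T.symm (S.ract x g⁻¹)))⁻¹ * g)⁻¹ =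
        S.T.symm (S.ract x g⁻¹) := by
      rw [mul_inv_rev, inv_inv, ract_mul]
      have := S.ract_T (S.T.symm (S.ract x g⁻¹))
      rwa [Equiv.apply_symm_apply] at this
    simp only [h, mul_inv_cancel_left]

/-- The left action of `G'` on the set `G_{(X,r)}` which `J` turns into left multiplication. -/
noncomputable def leftPermHom : S.G' →* Equiv.Perm S.G :=
  lift S.leftPerm fun a b => Equiv.ext fun g => by
    change S.ιG (S.ract a (S.ιG (S.ract b g⁻¹) * g)⁻¹) * (S.ιG (S.ract b g⁻¹) * g) =
      S.ιG (S.ract (S.rop b a) (S.ιG (S.ract a g⁻¹) * g)⁻¹) * (S.ιG (S.ract a g⁻¹) * g)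
    rw [mul_inv_rev, mul_inv_rev, ract_mul, ract_mul, ract_op, ract_ι_inv, ract_ι_inv,
      ← mul_assoc, ← mul_assoc, ιG_rel]
    simp [rop]

theorem leftPermHom_J (g : S.G) : S.leftPermHom (S.J g) 1 = g := by
  have e : ∀ x k, S.leftPermHom (S.ιG' x) k = S.ιG (S.ract x k⁻¹) * k := fun x k => by
    rw [leftPermHom, ιG', lift_ι]; rfl
  have step : ∀ x g, S.leftPermHom (S.J (S.ιG x * g)) 1 =
      S.ιG (S.ract (S.ract x g) (S.leftPermHom (S.J g) 1)⁻¹) * S.leftPermHom (S.J g) 1 := by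
    intro x g
    rw [J_mul, J_ι, gact_ι, map_mul, Equiv.Perm.mul_apply, e]
  induction g using induction_left with
  | one => simp
  | mul x g hg =>
    change S.leftPermHom (S.J (S.ιG x * g)) 1 = S.ιG x * g
    rw [step, hg, ← ract_mul, mul_inv_cancel, ract_one]
  | inv_mul x g hg =>
    change S.leftPermHom (S.J ((S.ιG x)⁻¹ * g)) 1 = (S.ιG x)⁻¹ * g
    set k := (S.ιG x)⁻¹ * g with hk
    have hg' : g = S.ιG x * k := by rw [hk, mul_inv_cancel_left]
    have s := S.J_mul (S.ιG x) k
    rw [J_ι, gact_ι] at s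
    apply (S.leftPerm (S.ract x k)).injective
    have l : ∀ m, S.leftPermHom (S.ιG' (S.ract x k)) m = S.leftPerm (S.ract x k) m := fun m => by
      rw [leftPermHom, ιG', lift_ι]
    rw [← l, ← Equiv.Perm.mul_apply, ← map_mul, ← s, ← hg', hg, hg']
    change _ = S.ιG (S.ract (S.ract x k) k⁻¹) * k
    rw [← ract_mul, mul_inv_cancel, ract_one]

theorem J_bijective : Function.Bijective S.J :=
  ⟨fun a b h => by rw [← S.leftPermHom_J a, h, S.leftPermHom_J b], S.J_surjective⟩

/-- `J` as a bijection. -/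
noncomputable def JEquiv : S.G ≃ S.G' := Equiv.ofBijective S.J S.J_bijective

/-- The `T`-twisted power `y^{[d]} = J⁻¹(y^d)`. -/
noncomputable def twistedPow (y : X) (d : ℕ) : S.G := S.JEquiv.symm (S.ιG' y ^ d)

/-- The conditions whose least solution `d` is the degree of `y`; `ρ_y` is `x ↦ x ◁ y`. -/
structure IsDegreeCandidate (y : X) (d : ℕ) : Prop where
  pos : 0 < d
  even : (∀ x, S.rop x y = x) → Even d
  rho : ∀ x, (fun x => S.rop x y)^[d] x = x
  right : ∀ x, S.ract x (S.twistedPow y d) = x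
  left : ∀ x, S.leftAct (S.twistedPow y d) x = x

/-- The degree `d_y`. It is well defined for finite `X`, see `degree_isLeast`. -/
noncomputable def degree (y : X) : ℕ := sInf {d | S.IsDegreeCandidate y d}

theorem J_twistedPow (y : X) (d : ℕ) : S.J (S.twistedPow y d) = S.ιG' y ^ d :=
  S.JEquiv.apply_symm_apply _

theorem twistedPow_succ_aux (y : X) (m : ℕ) :
    S.ract y (S.twistedPow y m)⁻¹ = (S.T ^ m) y ∧
    S.twistedPow y (m + 1) = S.ιG ((S.T ^ m) y) * S.twistedPow y m := by
  have step : ∀ m, S.twistedPow y (m + 1) =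
      S.ιG (S.ract y (S.twistedPow y m)⁻¹) * S.twistedPow y m := fun m => by
    apply S.J_bijective.1
    rw [J_mul, J_ι, gact_ι, ← ract_mul, inv_mul_cancel, ract_one, J_twistedPow, J_twistedPow,
      pow_succ']
  have h : ∀ m, S.ract y (S.twistedPow y m)⁻¹ = (S.T ^ m) y := by
    intro m
    induction m with
    | zero =>
      have : S.twistedPow y 0 = 1 := S.J_bijective.1 (by simp [J_twistedPow])
      simp [this]
    | succ m ih =>
      rw [step, ih, mul_inv_rev, ract_mul, ih, ract_ι_inv, pow_succ', Equiv.Perm.mul_apply]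
      rfl
  exact ⟨h m, by rw [step, h]⟩

theorem twistedPow_mul (y : X) (p : ℕ) (hp : S.T ^ p = 1) (m : ℕ) :
    S.twistedPow y (p * m) = S.twistedPow y p ^ m := by
  have h0 : S.twistedPow y 0 = 1 := S.J_bijective.1 (by simp [J_twistedPow])
  have hadd : ∀ a b, S.twistedPow y (p * a + b) = S.twistedPow y b * S.twistedPow y (p * a) := by
    intro a b
    induction b with
    | zero => simp [h0]
    | succ b ih =>
      rw [← Nat.add_assoc, (S.twistedPow_succ_aux y _).2, (S.twistedPow_succ_aux y b).2, ih,
        mul_assoc, pow_add, pow_mul, hp, one_pow, one_mul]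
  induction m with
  | zero => simp [h0]
  | succ m ih => rw [Nat.mul_succ, hadd, ih, pow_succ']

theorem op_right_injective (y : X) : Function.Injective fun x => S.rop x y := by
  intro x x' h
  have h := (S.τ y).injective h
  have : S.r ((S.τ x).symm y, x) = S.r ((S.τ x').symm y, x') := by
    rw [r_apply, r_apply, Equiv.apply_symm_apply, Equiv.apply_symm_apply, h]
  exact congrArg Prod.snd (S.bijective.1 this)

theorem degree_isLeast [Finite X] (y : X) :
    IsLeast {d | S.IsDegreeCandidate y d} (S.degree y) := by
  have hne : {d | S.IsDegreeCandidate y d}.Nonempty := by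
    set k := Nat.card (Equiv.Perm X) with hk
    have hkpos : 0 < k := Nat.card_pos
    have hpow : ∀ e : Equiv.Perm X, e ^ k = 1 := fun e => pow_card_eq_one'
    have hpow' : ∀ e : Equiv.Perm X, e ^ (2 * k) = 1 := fun e => by
      rw [mul_comm, pow_mul, hpow, one_pow]
    refine ⟨k * (2 * k), by positivity, fun _ => ⟨k * k, by ring⟩, fun x => ?_, fun x => ?_,
      fun x => ?_⟩
    · let e : Equiv.Perm X := Equiv.ofBijective _ (Finite.injective_iff_bijective.1
        (S.op_right_injective y))
      have h : (e ^ (k * (2 * k))) x = x := by rw [pow_mul, hpow, one_pow]; rfl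
      rw [← Equiv.Perm.iterate_eq_pow] at h
      exact h
    · rw [twistedPow_mul _ _ _ (hpow _), ract, map_pow, unop_pow, hpow']
      rfl
    · rw [twistedPow_mul _ _ _ (hpow _), map_pow, hpow']
      rfl
  exact ⟨Nat.sInf_mem hne, fun d hd => Nat.sInf_le hd⟩

/-- The subgroup `Z_{(X,r)}` generated by the `x^{[d_x]}`. -/
noncomputable def Z : Subgroup S.G :=
  Subgroup.closure (Set.range fun x => S.twistedPow x (S.degree x))

/-- The set of orbits of the structure rack: the quotient of `X` by the equivalence relation
generated by `x ∼ x ◁ y`. -/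
def RackOrbits : Type u := Quot fun x x' : X => ∃ y, x' = S.rop x y

/-- The number `K_r` of orbits of the structure rack. -/
noncomputable def K : ℕ := Nat.card S.RackOrbits

end Solution

end YBE

/-! The guitar map `J` is a bijective cocycle, so J(gh) = J(g)J(h) whenever h acts trivially on X
from the right. The generators x^{[d_x]} of Z act trivially, hence `J` embeds Z in G' as the
subgroup generated by the powers x^{d_x}, and sends cosets of Z to cosets of this image.

In G' conjugation by generators is the rack operation. As ρ_x^{d_x} = Id, x^{d_x} is central, so it
equals its conjugate (y ◁ x)-style powers along the whole rack orbit: one central element per orbit.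
Counting letters by orbit, `orbitCount`, maps these to d_x times distinct basis vectors of ℤ^K, so
they are independent and Z is free of rank K. Normality comes from `conj_twistedPow`: conjugation by
g turns y^{[d]} into (y ↼ g⁻¹)^{[d]}.

For finiteness, generators of G' have finite conjugacy classes, so the centre of G' has finite
index. Modulo J(Z) the generators are also torsion; Schur's theorem and the finiteness of finitely
generated torsion abelian groups conclude. For injectivity, the parity clause forces d_x ≥ 2, while
the orbit counts of two generators differ by entries in {-1, 0, 1}; the element of Z relating them
is therefore trivial. -/

namespace YBE

namespace Solution

open StructureGroup MulOpposite
open scoped IsMulCommutative commutatorElement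

variable {X : Type*} (S : Solution X)

/-! ### The structure rack and its group -/

/-- The operation of the structure rack is self-distributive. -/
theorem rop_rop (x y z : X) :
    S.rop (S.rop z y) x = S.rop (S.rop z x) (S.rop y x) := by
  -- The guitar map on triples intertwines r with the rack solution r' = (y ◁ x, x). Hence r'
  -- satisfies the Yang–Baxter equation, whose first component is self-distributivity.
  let Φ : X × X × X → X × X × X :=
    fun p => (S.τ p.2.2 (S.τ p.2.1 p.1), S.τ p.2.2 p.2.1, p.2.2)
  let r' : X × X → X × X := fun p => (S.rop p.2 p.1, p.1)
  have h₁ : ∀ p, Φ (r₁ S.r p) = r₁ r' (Φ p) := by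
    rintro ⟨a, b, c⟩
    simp only [Φ, r', r₁, r_apply, ← τ_op, op_τ]
  have h₂ : ∀ p, Φ (r₂ S.r p) = r₂ r' (Φ p) := by
    rintro ⟨a, b, c⟩
    simp only [Φ, r', r₂, r_apply, op_τ, (S.ybe_components a b c).2.2]
  -- An explicit preimage of (x, y, z) under Φ.
  have hΦ : Φ ((S.τ ((S.τ z).symm y)).symm ((S.τ z).symm x), (S.τ z).symm y, z) = (x, y, z) := by
    simp [Φ]
  have h := congrArg Φ (congrFun S.yangBaxter
    ((S.τ ((S.τ z).symm y)).symm ((S.τ z).symm x), (S.τ z).symm y, z))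
  simp only [Function.comp, h₁, h₂, hΦ] at h
  exact (congrArg Prod.fst h).symm

theorem ιG'_conj (x y : X) : S.ιG' x * S.ιG' y * (S.ιG' x)⁻¹ = S.ιG' (S.rop y x) := by
  rw [ιG'_rel, mul_inv_cancel_right]

theorem closure_range_ιG' : Subgroup.closure (Set.range S.ιG') = ⊤ :=
  PresentedGroup.closure_range_of _

theorem pow_ιG'_mul (x y : X) (n : ℕ) :
    S.ιG' y ^ n * S.ιG' x = S.ιG' ((fun x => S.rop x y)^[n] x) * S.ιG' y ^ n := by
  induction n with
  | zero => simp
  | succ n ih =>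
    rw [pow_succ', mul_assoc, ih, ← mul_assoc, ιG'_rel, mul_assoc, Function.iterate_succ_apply']

theorem mem_center_of_commute_ιG' {h : S.G'} (hh : ∀ x, h * S.ιG' x = S.ιG' x * h) :
    h ∈ Subgroup.center S.G' := by
  rw [← Subgroup.centralizer_univ, ← Subgroup.coe_top, ← S.closure_range_ιG',
    Subgroup.centralizer_closure, Subgroup.mem_centralizer_iff]
  rintro _ ⟨x, rfl⟩
  exact (hh x).symm

theorem gact_pow (h : S.G') (g : S.G) (n : ℕ) : S.gact (h ^ n) g = S.gact h g ^ n :=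
  map_pow _ _ _

/-! ### Central powers and twisted powers -/

variable {S}

theorem pow_ιG'_mem_center {y : X} {d : ℕ} (hd : ∀ x, (fun x => S.rop x y)^[d] x = x) :
    S.ιG' y ^ d ∈ Subgroup.center S.G' :=
  S.mem_center_of_commute_ιG' fun x => by rw [pow_ιG'_mul, hd]

/-- The twist in the cocycle rule is by the right factor only, so g may be arbitrary. -/
theorem J_mul_of_trivial {h : S.G} (hh : ∀ x, S.ract x h = x) (g : S.G) :
    S.J (g * h) = S.J g * S.J h := by
  have : (⟨(S.rightAct h).unop, S.rightAct_mem h⟩ : S.rackAut) = 1 :=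
    Subtype.ext (Equiv.ext hh)
  rw [J_mul, gact, this, map_one, MulAut.one_apply]

/-- The two generators are conjugate in G', and a central power is unchanged by conjugation. -/
theorem pow_ιG'_rop {y : X} {d : ℕ} (hd : ∀ x, (fun x => S.rop x y)^[d] x = x) (x : X) :
    S.ιG' (S.rop y x) ^ d = S.ιG' y ^ d := by
  rw [← ιG'_conj, conj_pow,
    Subgroup.mem_center_iff.1 (pow_ιG'_mem_center hd), mul_inv_cancel_right]

theorem twistedPow_rop {y : X} {d : ℕ} (hd : ∀ x, (fun x => S.rop x y)^[d] x = x) (x : X) :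
    S.twistedPow (S.rop y x) d = S.twistedPow y d := by
  rw [twistedPow, pow_ιG'_rop hd, twistedPow]

/-- Under `J`, the products g y^{[d]} and (y ↼ g⁻¹)^{[d]} g become J(g) y^d and y^d J(g), which
agree because y^d is central. -/
theorem conj_twistedPow {y : X} {d : ℕ} (hd : S.IsDegreeCandidate y d) (g : S.G) :
    g * S.twistedPow y d * g⁻¹ = S.twistedPow (S.ract y g⁻¹) d := by
  rw [mul_inv_eq_iff_eq_mul]
  apply S.J_bijective.1
  rw [J_mul_of_trivial hd.right, J_mul, J_twistedPow, J_twistedPow, gact_pow, gact_ι, ← ract_mul,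
    inv_mul_cancel, ract_one, Subgroup.mem_center_iff.1 (pow_ιG'_mem_center hd.rho)]

theorem ract_inv_ract (x : X) (g : S.G) : S.ract (S.ract x g⁻¹) g = x := by
  rw [← ract_mul, inv_mul_cancel, ract_one]

theorem ract_ract_inv (x : X) (g : S.G) : S.ract (S.ract x g) g⁻¹ = x := by
  rw [← ract_mul, mul_inv_cancel, ract_one]

/-- The rack conditions transfer because g acts by rack automorphisms, the action conditions because
the two twisted powers are conjugate in G. -/
theorem IsDegreeCandidate.ract {y : X} {d : ℕ} (hd : S.IsDegreeCandidate y d) (g : S.G) :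
    S.IsDegreeCandidate (S.ract y g) d := by
  have hc : S.twistedPow (S.ract y g) d = g⁻¹ * S.twistedPow y d * g := by
    simpa using (conj_twistedPow hd g⁻¹).symm
  refine ⟨hd.pos, fun h => hd.even fun x => ?_, fun x => ?_, fun x => ?_, fun x => ?_⟩
  · have := h (S.ract x g)
    rw [← ract_op] at this
    simpa [ract_ract_inv] using congrArg (fun x => S.ract x g⁻¹) this
  · have h : Function.Semiconj (fun x => S.ract x g) (fun x => S.rop x y)
        (fun x => S.rop x (S.ract y g)) := fun x => S.ract_op x y g
    have := h.iterate_right d (S.ract x g⁻¹)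
    simp only [hd.rho, ract_inv_ract] at this
    exact this.symm
  · rw [hc, ract_mul, ract_mul, hd.right, ract_inv_ract]
  · have h : S.leftAct (S.twistedPow y d) = 1 := Equiv.ext hd.left
    rw [hc, map_mul, map_mul, h, mul_one, ← map_mul, inv_mul_cancel, map_one, Equiv.Perm.one_apply]

theorem isDegreeCandidate_ract_iff {y : X} {d : ℕ} (g : S.G) :
    S.IsDegreeCandidate (S.ract y g) d ↔ S.IsDegreeCandidate y d :=
  ⟨fun h => by simpa [ract_ract_inv] using h.ract g⁻¹, fun h => h.ract g⟩

/-! ### Invariance of the degree and its lower bound -/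

variable (S)

theorem degree_ract (y : X) (g : S.G) : S.degree (S.ract y g) = S.degree y := by
  simp only [degree, isDegreeCandidate_ract_iff]

/-- The `d`-th power of `x ↦ x ◁ y` is the identity exactly when that of `x ↦ x ◁ (y ◁ z)` is. -/
theorem iterate_rop_rop [Finite X] (y z : X) (d : ℕ) :
    (∀ x, (fun x => S.rop x (S.rop y z))^[d] x = x) ↔ ∀ x, (fun x => S.rop x y)^[d] x = x := by
  -- Self-distributivity: ρ_z conjugates ρ_y into ρ_{y ◁ z}.
  have h : Function.Semiconj (fun x => S.rop x z) (fun x => S.rop x y)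
      (fun x => S.rop x (S.rop y z)) := fun x => S.rop_rop z y x
  constructor
  · intro hd x
    apply S.op_right_injective z
    have := h.iterate_right d x
    simp only [hd] at this
    exact this
  · intro hd x
    obtain ⟨x, rfl⟩ := Finite.surjective_of_injective (S.op_right_injective z) x
    have := h.iterate_right d x
    simp only [hd] at this
    exact this.symm

theorem isDegreeCandidate_rop [Finite X] (y z : X) (d : ℕ) :
    S.IsDegreeCandidate (S.rop y z) d ↔ S.IsDegreeCandidate y d := by
  -- Exponent 1 matches the hypothesis of the parity condition for y with that for y ◁ z.
  have h1 := S.iterate_rop_rop y z 1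
  simp only [Function.iterate_one] at h1
  constructor
  · rintro ⟨a, b, c, e, f⟩
    have c' := (S.iterate_rop_rop y z d).1 c
    rw [twistedPow_rop c'] at e f
    exact ⟨a, fun h => b (h1.2 h), c', e, f⟩
  · rintro ⟨a, b, c, e, f⟩
    refine ⟨a, fun h => b (h1.1 h), (S.iterate_rop_rop y z d).2 c, ?_, ?_⟩ <;>
      rwa [twistedPow_rop c]

theorem degree_rop [Finite X] (y z : X) : S.degree (S.rop y z) = S.degree y := by
  simp only [degree, isDegreeCandidate_rop]

theorem isDegreeCandidate_degree [Finite X] (y : X) : S.IsDegreeCandidate y (S.degree y) :=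
  (S.degree_isLeast y).1

/-- Degree 1 would mean ρ_y = Id, and then the parity condition requires an even degree. -/
theorem two_le_degree [Finite X] (y : X) : 2 ≤ S.degree y := by
  have h := S.isDegreeCandidate_degree y
  have hpos := h.pos
  by_contra hlt
  have h1 : S.degree y = 1 := by omega
  have hρ := h.rho
  rw [h1] at hρ
  have he := h.even hρ
  rw [h1] at he
  exact absurd he (by decide)

/-! ### Normality of Z and its image under the guitar map -/

/-- `Z_{(X,r)}` is normal. -/
theorem Z_normal [Finite X] : S.Z.Normal := by
  have hconj : ∀ g : S.G, S.Z ≤ S.Z.comap (MulAut.conj g).toMonoidHom := fun g => by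
    rw [Z, Subgroup.closure_le]
    rintro _ ⟨y, rfl⟩
    refine Subgroup.subset_closure ⟨S.ract y g⁻¹, ?_⟩
    simp only [degree_ract]
    exact (conj_twistedPow (S.isDegreeCandidate_degree y) g).symm
  exact ⟨fun z hz g => hconj g hz⟩

theorem ract_of_mem_Z [Finite X] {z : S.G} (hz : z ∈ S.Z) (x : X) : S.ract x z = x := by
  have h : S.Z ≤ S.rightAct.ker := by
    rw [Z, Subgroup.closure_le]
    rintro _ ⟨y, rfl⟩
    exact unop_injective (Equiv.ext (S.isDegreeCandidate_degree y).right)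
  rw [ract, h hz]
  rfl

/-- The guitar map restricts to a group homomorphism on `Z_{(X,r)}`. -/
noncomputable def JZ [Finite X] : S.Z →* S.G' where
  toFun z := S.J z
  map_one' := S.J_one
  map_mul' a b := J_mul_of_trivial (S.ract_of_mem_Z b.2) a

@[simp] theorem JZ_apply [Finite X] (z : S.Z) : S.JZ z = S.J z := rfl

theorem JZ_injective [Finite X] : Function.Injective S.JZ :=
  fun _ _ h => Subtype.ext (S.J_bijective.1 h)

/-- The element `x^{d_x}` of the centre of `G'`. -/
noncomputable def centralPow [Finite X] (x : X) : Subgroup.center S.G' :=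
  ⟨S.ιG' x ^ S.degree x, pow_ιG'_mem_center (S.isDegreeCandidate_degree x).rho⟩

theorem centralPow_rop [Finite X] (x y : X) : S.centralPow (S.rop x y) = S.centralPow x :=
  Subtype.ext <| by
    change S.ιG' (S.rop x y) ^ S.degree (S.rop x y) = S.ιG' x ^ S.degree x
    rw [degree_rop, pow_ιG'_rop (S.isDegreeCandidate_degree x).rho]

theorem range_JZ [Finite X] :
    S.JZ.range = Subgroup.closure (Set.range fun x => S.ιG' x ^ S.degree x) := by
  -- Regarded inside itself, Z is generated by the same elements, so its image is generated by
  -- theirs.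
  have h : (⊤ : Subgroup S.Z) = Subgroup.closure
      ((fun z : S.Z => (z : S.G)) ⁻¹' Set.range fun x => S.twistedPow x (S.degree x)) :=
    (Subgroup.closure_closure_coe_preimage).symm
  rw [MonoidHom.range_eq_map, h, MonoidHom.map_closure]
  congr 1
  ext w
  constructor
  · rintro ⟨z, ⟨x, hx⟩, rfl⟩
    refine ⟨x, ?_⟩
    simp only at hx
    rw [JZ_apply, ← hx, J_twistedPow]
  · rintro ⟨x, rfl⟩
    exact ⟨⟨_, Subgroup.subset_closure ⟨x, rfl⟩⟩, ⟨x, rfl⟩, S.J_twistedPow x _⟩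

/-! ### Rack orbits and freeness of Z -/

instance [Finite X] : Finite S.RackOrbits :=
  inferInstanceAs (Finite (Quot _))

/-- The orbit of an element, numbered. -/
noncomputable def orbitIndex [Finite X] (x : X) : Fin S.K :=
  Finite.equivFin S.RackOrbits (Quot.mk _ x)

theorem orbitIndex_surjective [Finite X] : Function.Surjective S.orbitIndex :=
  (Finite.equivFin S.RackOrbits).surjective.comp Quot.mk_surjective

theorem orbitIndex_rop [Finite X] (x y : X) : S.orbitIndex (S.rop x y) = S.orbitIndex x :=
  congrArg (Finite.equivFin S.RackOrbits) (Quot.sound ⟨y, rfl⟩).symm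

/-- A function on `X` invariant under the right translations depends only on the orbit. -/
theorem eq_of_orbitIndex_eq [Finite X] {α : Type*} {f : X → α}
    (hf : ∀ x y, f (S.rop x y) = f x) {x x' : X} (h : S.orbitIndex x = S.orbitIndex x') :
    f x = f x' := by
  have h := (Finite.equivFin S.RackOrbits).injective h
  exact congrArg (Quot.lift f (by rintro a _ ⟨y, rfl⟩; exact (hf a y).symm)) h

/-- A representative of an orbit. -/
noncomputable def orbitRep [Finite X] (i : Fin S.K) : X := (S.orbitIndex_surjective i).choose

@[simp] theorem orbitIndex_orbitRep [Finite X] (i : Fin S.K) : S.orbitIndex (S.orbitRep i) = i :=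
  (S.orbitIndex_surjective i).choose_spec

/-- The homomorphism `G' → ℤ^K` sending a generator to the basis vector of its orbit. -/
noncomputable def orbitCount [Finite X] : S.G' →* Multiplicative (Fin S.K → ℤ) :=
  lift (fun x => Multiplicative.ofAdd (Pi.single (S.orbitIndex x) 1)) fun x y => by
    simp only [orbitIndex_rop]
    exact mul_comm _ _

@[simp] theorem orbitCount_ι [Finite X] (x : X) :
    S.orbitCount (S.ιG' x) = Multiplicative.ofAdd (Pi.single (S.orbitIndex x) 1) :=
  lift_ι _ _ x

/-- The homomorphism `ℤ^K → G'` sending the basis vector of an orbit to `x^{d_x}`, where `x` is any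
element of this orbit. -/
noncomputable def centralHom [Finite X] : Multiplicative (Fin S.K → ℤ) →* S.G' :=
  -- The product is formed in the centre, where commutativity makes it multiplicative in k.
  (Subgroup.center S.G').subtype.comp
    { toFun := fun k => ∏ i, S.centralPow (S.orbitRep i) ^ k.toAdd i
      map_one' := by simp
      map_mul' := fun k l => by simp [zpow_add, Finset.prod_mul_distrib] }

theorem centralHom_apply [Finite X] (k : Multiplicative (Fin S.K → ℤ)) :
    S.centralHom k =
      ((∏ i, S.centralPow (S.orbitRep i) ^ k.toAdd i : Subgroup.center S.G') : S.G') := rfl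

/-- The composite ℤ^K → G' → ℤ^K is the diagonal matrix of degrees. This gives the independence of
the central powers and, later, the comparison of generators modulo Z. -/
theorem orbitCount_centralHom [Finite X] (k : Multiplicative (Fin S.K → ℤ)) (i : Fin S.K) :
    (S.orbitCount (S.centralHom k)).toAdd i = S.degree (S.orbitRep i) * k.toAdd i := by
  have h : ∀ j, (S.orbitCount (S.centralPow (S.orbitRep j))) =
      Multiplicative.ofAdd (Pi.single j (S.degree (S.orbitRep j) : ℤ)) := fun j => by
    change S.orbitCount (S.ιG' _ ^ _) = _
    rw [map_pow, orbitCount_ι, orbitIndex_orbitRep, ← ofAdd_nsmul, ← Pi.single_smul]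
    simp
  have e : S.orbitCount (S.centralHom k) =
      ∏ j, S.orbitCount (S.centralPow (S.orbitRep j)) ^ k.toAdd j := by
    rw [centralHom_apply]
    change (S.orbitCount.comp (Subgroup.center S.G').subtype) _ = _
    simp only [map_prod, map_zpow]
    rfl
  rw [e, toAdd_prod, Finset.sum_apply, Finset.sum_eq_single i]
  · rw [h, toAdd_zpow]
    simp [mul_comm]
  · intro j _ hj
    rw [h, toAdd_zpow]
    simp [Pi.single_eq_of_ne hj.symm]
  · simp

theorem centralHom_injective [Finite X] : Function.Injective S.centralHom := by
  rw [injective_iff_map_eq_one]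
  intro k hk
  refine Multiplicative.toAdd.injective (funext fun i => ?_)
  have h := S.orbitCount_centralHom k i
  rw [hk, map_one] at h
  have hd := S.two_le_degree (S.orbitRep i)
  have : (S.degree (S.orbitRep i) : ℤ) ≠ 0 := by omega
  exact (mul_eq_zero.1 h.symm).resolve_left this

theorem range_centralHom [Finite X] : S.centralHom.range = S.JZ.range := by
  rw [range_JZ]
  apply le_antisymm
  · rintro _ ⟨k, rfl⟩
    rw [centralHom_apply]
    set C := Subgroup.closure (Set.range fun x => S.ιG' x ^ S.degree x)
    -- Membership is tested inside the centre, since the product only makes sense in a commutative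
    -- group.
    suffices h : (∏ i, S.centralPow (S.orbitRep i) ^ k.toAdd i) ∈
        C.subgroupOf (Subgroup.center S.G') from h
    refine Subgroup.prod_mem _ fun i _ => Subgroup.zpow_mem _ ?_ _
    exact Subgroup.subset_closure ⟨S.orbitRep i, rfl⟩
  · rw [Subgroup.closure_le]
    rintro _ ⟨x, rfl⟩
    refine ⟨Multiplicative.ofAdd (Pi.single (S.orbitIndex x) 1), ?_⟩
    rw [centralHom_apply, Finset.prod_eq_single (S.orbitIndex x)]
    · have := S.eq_of_orbitIndex_eq S.centralPow_rop (S.orbitIndex_orbitRep (S.orbitIndex x))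
      simpa [centralPow] using congrArg Subtype.val this
    · intro j _ hj
      simp [Pi.single_eq_of_ne hj]
    · simp

/-- `Z_{(X,r)}` is free abelian of rank `K_r`. -/
theorem Z_free [Finite X] : Nonempty (S.Z ≃* Multiplicative (Fin S.K → ℤ)) :=
  ⟨(MonoidHom.ofInjective S.JZ_injective).trans <|
    (MulEquiv.subgroupCongr S.range_centralHom.symm).trans
      (MonoidHom.ofInjective S.centralHom_injective).symm⟩

/-! ### Finiteness of the quotient -/

/-- Bounds the conjugacy class of a generator by the finite set of generators. Conjugating by an
inverse uses that right translations of a finite rack are surjective. -/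
theorem conj_mem_range_ιG' [Finite X] (g : S.G') (x : X) :
    g * S.ιG' x * g⁻¹ ∈ Set.range S.ιG' := by
  induction g using induction_left generalizing x with
  | one => simp
  | mul y g ih =>
    obtain ⟨z, hz⟩ := ih x
    refine ⟨S.rop z y, ?_⟩
    rw [← ιG'_conj, hz]
    change S.ιG' y * _ * _ = S.ιG' y * g * _ * (S.ιG' y * g)⁻¹
    group
  | inv_mul y g ih =>
    obtain ⟨z, hz⟩ := ih x
    obtain ⟨w, rfl⟩ := Finite.surjective_of_injective (S.op_right_injective y) z
    refine ⟨w, ?_⟩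
    change S.ιG' (S.rop w y) = _ at hz
    rw [← ιG'_conj] at hz
    change _ = (S.ιG' y)⁻¹ * g * _ * ((S.ιG' y)⁻¹ * g)⁻¹
    have : (S.ιG' y)⁻¹ * g * S.ιG' x * ((S.ιG' y)⁻¹ * g)⁻¹ =
      (S.ιG' y)⁻¹ * (g * S.ιG' x * g⁻¹) * S.ιG' y := by group
    rw [this, ← hz]
    group

/-- The centre is the intersection of the centralizers of finitely many generators, each of finite
index because its generator has a finite conjugacy class. -/
instance [Finite X] : (Subgroup.center S.G').FiniteIndex := by
  have h : Subgroup.center S.G' = ⨅ x, Subgroup.centralizer {S.ιG' x} := by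
    apply le_antisymm
    · exact le_iInf fun x => Subgroup.center_le_centralizer _
    · intro g hg
      refine S.mem_center_of_commute_ιG' fun x => ?_
      exact (Subgroup.mem_centralizer_singleton_iff.1 (Subgroup.mem_iInf.1 hg x))
  have hx : ∀ x, (Subgroup.centralizer {S.ιG' x}).FiniteIndex := fun x => by
    rw [Subgroup.finiteIndex_iff_finite_quotient]
    -- Orbit–stabilizer: cosets of the centralizer correspond to conjugates.
    let f : S.G' ⧸ Subgroup.centralizer {S.ιG' x} → Set.range S.ιG' :=
      Quotient.lift (fun g => ⟨g * S.ιG' x * g⁻¹, S.conj_mem_range_ιG' g x⟩) fun a b hab => by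
        have hab := Subgroup.mem_centralizer_singleton_iff.1 (QuotientGroup.leftRel_apply.1 hab)
        refine Subtype.ext ?_
        simp only
        rw [mul_inv_eq_iff_eq_mul]
        have : b * S.ιG' x * b⁻¹ * a = a * (a⁻¹ * b * S.ιG' x) * (a⁻¹ * b)⁻¹ := by group
        rw [this, hab]
        group
    refine Finite.of_injective f fun a b => ?_
    induction a using QuotientGroup.induction_on
    induction b using QuotientGroup.induction_on
    rename_i a b
    intro hab
    have hab : a * S.ιG' x * a⁻¹ = b * S.ιG' x * b⁻¹ := congrArg Subtype.val hab
    rw [QuotientGroup.eq, Subgroup.mem_centralizer_singleton_iff]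
    rw [mul_inv_eq_iff_eq_mul] at hab
    rw [mul_assoc, inv_mul_eq_iff_eq_mul]
    have : a * (S.ιG' x * (a⁻¹ * b)) = a * S.ιG' x * a⁻¹ * b := by group
    rw [this, hab]
    group
  rw [h]
  exact Subgroup.finiteIndex_iInf hx

/-- A commutator depends only on the classes of its two entries modulo the centre. -/
theorem _root_.finite_commutatorSet_of_finiteIndex_center {H : Type*} [Group H]
    [(Subgroup.center H).FiniteIndex] : Finite (commutatorSet H) := by
  refine Set.Finite.subset (Set.finite_range
    fun p : (H ⧸ Subgroup.center H) × (H ⧸ Subgroup.center H) => ⁅p.1.out, p.2.out⁆) ?_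
  rintro _ ⟨a, b, rfl⟩
  refine ⟨(a, b), ?_⟩
  obtain ⟨⟨c, hc⟩, ha⟩ := QuotientGroup.mk_out_eq_mul (Subgroup.center H) a
  obtain ⟨⟨d, hd⟩, hb⟩ := QuotientGroup.mk_out_eq_mul (Subgroup.center H) b
  simp only [ha, hb, commutatorElement_def, mul_inv_rev]
  have hc := Subgroup.mem_center_iff.1 hc
  have hd := Subgroup.mem_center_iff.1 hd
  calc a * c * (b * d) * (c⁻¹ * a⁻¹) * (d⁻¹ * b⁻¹)
      = a * (c * (b * d)) * c⁻¹ * a⁻¹ * d⁻¹ * b⁻¹ := by group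
    _ = a * b * (d * a⁻¹) * d⁻¹ * b⁻¹ := by rw [← hc]; group
    _ = a * b * a⁻¹ * b⁻¹ := by rw [← hd]; group

/-- A finitely generated group whose centre has finite index is finite when it is generated by
elements of finite order. -/
theorem _root_.Group.finite_of_finiteIndex_center {H : Type*} [Group H]
    [(Subgroup.center H).FiniteIndex] {s : Set H} (hs : s.Finite)
    (hgen : Subgroup.closure s = ⊤) (htors : ∀ a ∈ s, IsOfFinOrder a) : Finite H := by
  have : Group.FG H := Group.fg_iff.2 ⟨s, hgen, hs⟩
  have : Finite (commutatorSet H) := finite_commutatorSet_of_finiteIndex_center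
  have : Group.FG (Abelianization H) :=
    Group.fg_of_surjective (f := Abelianization.of) QuotientGroup.mk_surjective
  have : Finite (Abelianization H) := by
    -- In an abelian group the torsion elements form a subgroup, so torsion need only be checked on
    -- generators.
    refine CommGroup.finite_of_fg_isMulTorsion _ fun a => ?_
    obtain ⟨a, rfl⟩ := QuotientGroup.mk_surjective a
    have ha : a ∈ Subgroup.closure s := hgen ▸ Subgroup.mem_top a
    change a ∈ (CommGroup.torsion (Abelianization H)).comap Abelianization.of
    revert a
    change Subgroup.closure s ≤ _
    rw [Subgroup.closure_le]
    exact fun b hb => MonoidHom.isOfFinOrder _ (htors b hb)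
  have : Finite (H ⧸ commutator H) := ‹Finite (Abelianization H)›
  -- The commutator subgroup is finite by Schur's theorem, since there are finitely many
  -- commutators.
  exact Finite.of_subgroup_quotient (commutator H)

theorem finite_quotient_range_JZ [Finite X] : Finite (S.G' ⧸ S.JZ.range) := by
  have hle : S.JZ.range ≤ Subgroup.center S.G' := by
    rw [← range_centralHom]
    rintro _ ⟨k, rfl⟩
    exact Subtype.property _
  have : S.JZ.range.Normal := ⟨fun z hz g => by
    rwa [Subgroup.mem_center_iff.1 (hle hz), mul_inv_cancel_right]⟩
  let q := QuotientGroup.mk' S.JZ.range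
  have hq : Function.Surjective q := QuotientGroup.mk'_surjective _
  have : (Subgroup.center (S.G' ⧸ S.JZ.range)).FiniteIndex := by
    have h1 : Subgroup.map q (Subgroup.center S.G') ≤ Subgroup.center (S.G' ⧸ S.JZ.range) := by
      rintro _ ⟨c, hc, rfl⟩
      rw [Subgroup.mem_center_iff]
      intro g
      obtain ⟨g, rfl⟩ := hq g
      rw [← map_mul, ← map_mul, Subgroup.mem_center_iff.1 hc]
    have : (Subgroup.map q (Subgroup.center S.G')).FiniteIndex :=
      ⟨fun h0 => Subgroup.FiniteIndex.index_ne_zero (H := Subgroup.center S.G')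
        (Nat.eq_zero_of_zero_dvd (h0 ▸ Subgroup.index_map_dvd _ hq))⟩
    exact Subgroup.finiteIndex_of_le h1
  refine Group.finite_of_finiteIndex_center (s := q '' Set.range S.ιG')
    ((Set.finite_range _).image _) ?_ ?_
  · rw [← MonoidHom.map_closure, closure_range_ιG', Subgroup.map_top_of_surjective _ hq]
  · rintro _ ⟨_, ⟨x, rfl⟩, rfl⟩
    rw [isOfFinOrder_iff_pow_eq_one]
    refine ⟨S.degree x, (S.isDegreeCandidate_degree x).pos, ?_⟩
    rw [← map_pow]
    refine (QuotientGroup.eq_one_iff _).2 ?_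
    rw [range_JZ]
    exact Subgroup.subset_closure ⟨x, rfl⟩

/-- `Z_{(X,r)}` has finite index. -/
theorem finite_quotient_Z [Finite X] : Finite (S.G ⧸ S.Z) := by
  have := S.finite_quotient_range_JZ
  -- Only a map of coset spaces: `J` is not a homomorphism on G, but J(az) = J(a)J(z) for z in Z.
  let f : S.G ⧸ S.Z → S.G' ⧸ S.JZ.range :=
    Quotient.lift (fun g => QuotientGroup.mk (S.J g)) fun a b hab => by
      have hab : a⁻¹ * b ∈ S.Z := QuotientGroup.leftRel_apply.1 hab
      rw [QuotientGroup.eq]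
      refine ⟨⟨_, hab⟩, ?_⟩
      rw [eq_inv_mul_iff_mul_eq, JZ_apply, ← J_mul_of_trivial (S.ract_of_mem_Z hab),
        mul_inv_cancel_left]
  refine Finite.of_injective f fun a b => ?_
  induction a using QuotientGroup.induction_on
  induction b using QuotientGroup.induction_on
  rename_i a b
  intro hab
  obtain ⟨z, hz⟩ := QuotientGroup.eq.1 (show (QuotientGroup.mk (S.J a) : S.G' ⧸ S.JZ.range) =
    QuotientGroup.mk (S.J b) from hab)
  rw [QuotientGroup.eq]
  rw [eq_inv_mul_iff_mul_eq, JZ_apply, ← J_mul_of_trivial (S.ract_of_mem_Z z.2)] at hz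
  rw [← S.J_bijective.1 hz, inv_mul_cancel_left]
  exact z.2

/-! ### Injectivity modulo Z -/

/-- Generators which agree modulo `Z_{(X,r)}` agree in `G_{(X,r)}`. -/
theorem ιG_eq_of_mk_eq [Finite X] {x y : X} (h : (S.ιG x)⁻¹ * S.ιG y ∈ S.Z) :
    S.ιG x = S.ιG y := by
  have hJ : S.ιG' y = S.ιG' x * S.J ((S.ιG x)⁻¹ * S.ιG y) := by
    rw [← J_ι, ← J_ι, ← J_mul_of_trivial (S.ract_of_mem_Z h), mul_inv_cancel_left]
  have hmem : S.J ((S.ιG x)⁻¹ * S.ιG y) ∈ S.centralHom.range :=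
    S.range_centralHom ▸ ⟨⟨_, h⟩, rfl⟩
  obtain ⟨k, hk⟩ := hmem
  rw [← hk] at hJ
  -- Counting letters by orbit in the relation y = x · c, where c is the image of k in the centre.
  have hcoord : ∀ i, (Pi.single (S.orbitIndex y) 1 : Fin S.K → ℤ) i =
      (Pi.single (S.orbitIndex x) 1 : Fin S.K → ℤ) i + S.degree (S.orbitRep i) * k.toAdd i := by
    intro i
    have := congrArg (fun g => (S.orbitCount g).toAdd i) hJ
    simpa [orbitCount_centralHom] using this
  have hk1 : k = 1 := by
    refine Multiplicative.toAdd.injective (funext fun i => ?_)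
    have hi := hcoord i
    have hd : (2 : ℤ) ≤ S.degree (S.orbitRep i) := by exact_mod_cast S.two_le_degree _
    change k.toAdd i = 0
    -- A difference of entries of unit vectors has absolute value at most 1, below the degree; being
    -- a multiple of the degree, it vanishes.
    have hsmall : |(S.degree (S.orbitRep i) : ℤ) * k.toAdd i| < S.degree (S.orbitRep i) := by
      rw [show (S.degree (S.orbitRep i) : ℤ) * k.toAdd i =
        (Pi.single (S.orbitIndex y) 1 : Fin S.K → ℤ) i -
          (Pi.single (S.orbitIndex x) 1 : Fin S.K → ℤ) i by omega, abs_lt]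
      simp only [Pi.single_apply]
      split_ifs <;> omega
    have := Int.eq_zero_of_abs_lt_dvd (Dvd.intro _ rfl) hsmall
    exact (mul_eq_zero.1 this).resolve_left (by omega)
  rw [hk1, map_one, mul_one] at hJ
  apply S.J_bijective.1
  rw [J_ι, J_ι, hJ]

end Solution

end YBE

theorem mainTheorem1 {X : Type*} [Finite X] (S : YBE.Solution X) :
    S.Z.Normal ∧
    Nonempty (S.Z ≃* Multiplicative (Fin S.K → ℤ)) ∧
    Finite (S.G ⧸ S.Z) ∧
    (Function.Injective S.ιG ↔
      Function.Injective fun x : X => (QuotientGroup.mk (S.ιG x) : S.G ⧸ S.Z)) :=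
  ⟨S.Z_normal, S.Z_free, S.finite_quotient_Z,
    fun h _ _ hxy => h (S.ιG_eq_of_mk_eq (QuotientGroup.eq.1 hxy)),
    fun h _ _ hxy => h (congrArg QuotientGroup.mk hxy)⟩
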